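/- Let $M\subset\mathbb{R}^d$ be a closed subset that is a smooth embedded submanifold without boundary, of dimension $m$ (not necessarily compact or connected), and let $I=[0,T]$ with $T\ge 0$, or $I=[0,\infty)$. For $q\in M$ let $\Pi_q$ be the orthogonal projector of $\mathbb{R}^d$ onto $T_qM$. Let $S$ be $M$ or an open subset of $\mathbb{R}^d$ (with $T_qS=\mathbb{R}^d$ in the latter case), and let $K:TS\to\mathbb{R}$ and $w_0:S\to\mathbb{R}$. Consider the Cauchy problem on $I\times S$ with Hamiltonian $K$ and initial condition $w_0$: $$\partial_t w(t,q)+K\bigl(q,\nabla_q w(t,q)\bigr)=0\quad ((t,q)\in I\times S),\qquad w(0,q)=w_0(q)\quad (q\in S),$$ where $\nabla_q w(t,q)\in T_qS$ is the gradient along $S$ for the Euclidean metric. A classical solution is a function $w$ differentiable on $I\times S$ (one-sided in time at the ends of $I$) that satisfies these equations; if $T=0$, the differential of $w$ may have any time component that satisfies the equation. A locally Lipschitz viscosity solution is a locally Lipschitz $w:I\times S\to\mathbb{R}$ with $w(0,\cdot)=w_0$ such that, for every $(t,q)$ with $t$ in the interior of $I$ and $q\in S$ and every $C^1$ function $\phi$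 on a neighbourhood of $(t,q)$ in $\mathbb{R}\times S$: if $w-\phi$ has a local maximum at $(t,q)$ then $\partial_t\phi(t,q)+K(q,\nabla_q\phi(t,q))\le 0$, and if $w-\phi$ has a local minimum at $(t,q)$ then $\partial_t\phi(t,q)+K(q,\nabla_q\phi(t,q))\ge 0$. (a) Let $H:\mathbb{R}^d\times\mathbb{R}^d\to\mathbb{R}$ be of class $C^2$ and $u_0:\mathbb{R}^d\to\mathbb{R}$ be Lipschitz. Suppose that $M\times\mathbb{R}^d$ is invariant under the (local) flow of the Hamiltonian vector field $X_H(q,p)=(\nabla_pH(q,p),-\nabla_qH(q,p))$. If $u$ is a classical solution (respectively, a locally Lipschitz viscosity solution) of the Cauchy problem on $I\times\mathbb{R}^d$ with Hamiltonian $H$ and initial condition $u_0$, then $u|_{I\times M}$ is a classical solution (respectively, a locally Lipschitz viscosity solution) of the Cauchy problem on $I\times M$ with Hamiltonian $H|_{TM}$ and initial condition $u_0|_M$. (b) Let $\theta:M\to(0,\infty)$ be continuous and such that, with $N_\theta=\{(q,n): q\in M,\ n\in (T_qM)^\perp,\ \|n\|<\theta(q)\}$, the map $\psi:N_\theta\to\mathbb{R}^d$,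 $\psi(q,n)=q+n$, is a smooth diffeomorphism onto its open image $U_\theta$. For $q\in U_\theta$ let $\tilde q\in M$ be the first component of $\psi^{-1}(q)$, and let $v(q)$ be the restriction to $T_{\tilde q}M$ of the differential at $q$ of the map $q\mapsto\tilde q$. Then $v(q)$ is an automorphism of $T_{\tilde q}M$ for every $q\in U_\theta$. Moreover, let $\bar H:TM\to\mathbb{R}$ and $\bar u_0:M\to\mathbb{R}$ be of class $C^1$, let $\bar u$ be a classical solution (respectively, a locally Lipschitz viscosity solution) of the Cauchy problem on $I\times M$ with Hamiltonian $\bar H$ and initial condition $\bar u_0$, and let $a\in\mathbb{R}$. Define, for $q\in U_\theta$, $p\in\mathbb{R}^d$ and $t\in I$, $$H(q,p)=\bar H\bigl(\tilde q,\,v(q)^{-1}\Pi_{\tilde q}\,p\bigr),\qquad u_0(q)=\bar u_0(\tilde q)+a\|q-\tilde q\|^2,\qquad u(t,q)=\bar u(t,\tilde q)+a\|q-\tilde q\|^2 .$$ Then $u$ is a classical solution (respectively, a locally Lipschitz viscosity solution) of the Cauchy problem on $I\times U_\theta$ with Hamiltonian $H$ and initial condition $u_0$. -/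

import Mathlib

open Set Filter Topology
open scoped ContDiff

noncomputable section

/-- Euclidean space `ℝ^d`. -/
abbrev Euc (d : ℕ) : Type := EuclideanSpace ℝ (Fin d)

/-- `M` is a smooth embedded `m`-dimensional submanifold (without boundary) of `ℝ^d`: around every
point of `M` there is a smooth diffeomorphism between open sets of `ℝ^d` that maps `M` onto an
`m`-dimensional linear subspace. -/
def IsSmoothSubmanifold {d : ℕ} (m : ℕ) (M : Set (Euc d)) : Prop :=
  ∀ q ∈ M, ∃ (e : OpenPartialHomeomorph (Euc d) (Euc d)) (W : Submodule ℝ (Euc d)),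
    Module.finrank ℝ W = m ∧ q ∈ e.source ∧
    ContDiffOn ℝ ∞ e e.source ∧ ContDiffOn ℝ ∞ e.symm e.target ∧
    ∀ x ∈ e.source, (x ∈ M ↔ e x ∈ W)

/-- The tangent space `T_q S ⊆ ℝ^d`, generated by the velocities of the smooth curves in `S`
through `q`. (For a submanifold, in particular for an open set, the velocities
already form a linear subspace.) -/
def tangentAt {d : ℕ} (S : Set (Euc d)) (q : Euc d) : Submodule ℝ (Euc d) :=
  Submodule.span ℝ {w | ∃ γ : ℝ → Euc d, ContDiffAt ℝ ∞ γ 0 ∧ γ 0 = q ∧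
    (∀ᶠ t in 𝓝 (0 : ℝ), γ t ∈ S) ∧ deriv γ 0 = w}

/-- The tangent bundle `TS`, as a subset of `ℝ^d × ℝ^d`. -/
def tangentBundleSet {d : ℕ} (S : Set (Euc d)) : Set (Euc d × Euc d) :=
  {x | x.1 ∈ S ∧ x.2 ∈ tangentAt S x.1}

/-- The orthogonal projector of `ℝ^d` onto `T_q S`, with values in `T_q S`. -/
def tangentProj {d : ℕ} (S : Set (Euc d)) (q : Euc d) : Euc d →L[ℝ] tangentAt S q :=
  (tangentAt S q).orthogonalProjectionOnto

/-- `I = [0, T]` for some `T ≥ 0`, or `I = [0, ∞)`. -/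
def IsTimeInterval (I : Set ℝ) : Prop :=
  (∃ T : ℝ, 0 ≤ T ∧ I = Icc 0 T) ∨ I = Ici 0

/-! ### The Cauchy problem on `I × S`

Below, `S` is a submanifold of `ℝ^d` (an open subset, for instance all of `ℝ^d`, is one). A function
on `S`, on `I × S` or on `TS` is represented by a function on the ambient space of which only
the values on `S`, on `I × S` or on `TS` matter. Passing to a smaller
`S` with the same ambient functions is therefore restriction. -/

/-- The component along time of a linear form on `ℝ × ℝ^d`. -/
def timePart {d : ℕ} (L : ℝ × Euc d →L[ℝ] ℝ) : ℝ := L (1, 0)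

/-- The gradient along `S` at `q` of a function with differential `L`: the vector of `T_q S` that
represents, for the Euclidean inner product, the restriction of `L` to `{0} × T_q S`. -/
def spaceGrad {d : ℕ} (S : Set (Euc d)) (q : Euc d) (L : ℝ × Euc d →L[ℝ] ℝ) : tangentAt S q :=
  (InnerProductSpace.toDual ℝ (tangentAt S q)).symm
    ((L.comp (ContinuousLinearMap.inr ℝ ℝ (Euc d))).comp (tangentAt S q).subtypeL)

/-- The value of `∂_t f + H (q, ∇_q f)` for a function `f` on `I × S` with differential `L` at a
point of `I × {q}`. -/
def hjValue {d : ℕ} (S : Set (Euc d)) (H : Euc d × Euc d → ℝ) (q : Euc d)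
    (L : ℝ × Euc d →L[ℝ] ℝ) : ℝ :=
  timePart L + H (q, (spaceGrad S q L : Euc d))

/-- `u` is a classical (differentiable) solution on `I × S` of
`∂_t u + H (q, ∇_q u) = 0`, `u (0, ·) = u₀`. Differentiability is that of a function on `I × S`,
hence one-sided in time at the ends of `I`. -/
def IsClassicalSolution {d : ℕ} (I : Set ℝ) (S : Set (Euc d)) (H : Euc d × Euc d → ℝ)
    (u₀ : Euc d → ℝ) (u : ℝ × Euc d → ℝ) : Prop :=
  (∀ t ∈ I, ∀ q ∈ S, ∃ L : ℝ × Euc d →L[ℝ] ℝ,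
    HasFDerivWithinAt u L (I ×ˢ S) (t, q) ∧ hjValue S H q L = 0) ∧
  ∀ q ∈ S, u (0, q) = u₀ q

/-- Viscosity subsolution of `∂_t u + H (q, ∇_q u) = 0` on `I × S`: the inequality `≤ 0` holds for
every `C¹` test function that touches `u` from above, up to a constant, at a point whose time is
interior to `I`. -/
def IsViscositySubsolution {d : ℕ} (I : Set ℝ) (S : Set (Euc d)) (H : Euc d × Euc d → ℝ)
    (u : ℝ × Euc d → ℝ) : Prop :=
  ∀ t ∈ interior I, ∀ q ∈ S, ∀ f : ℝ × Euc d → ℝ,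
    ContDiffWithinAt ℝ 1 f (univ ×ˢ S) (t, q) →
    IsLocalMaxOn (fun x => u x - f x) (I ×ˢ S) (t, q) →
    ∀ L : ℝ × Euc d →L[ℝ] ℝ, HasFDerivWithinAt f L (univ ×ˢ S) (t, q) → hjValue S H q L ≤ 0

/-- Viscosity supersolution: the inequality `≥ 0` holds for every `C¹` test function that touches
`u` from below. -/
def IsViscositySupersolution {d : ℕ} (I : Set ℝ) (S : Set (Euc d)) (H : Euc d × Euc d → ℝ)
    (u : ℝ × Euc d → ℝ) : Prop :=
  ∀ t ∈ interior I, ∀ q ∈ S, ∀ f : ℝ × Euc d → ℝ,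
    ContDiffWithinAt ℝ 1 f (univ ×ˢ S) (t, q) →
    IsLocalMinOn (fun x => u x - f x) (I ×ˢ S) (t, q) →
    ∀ L : ℝ × Euc d →L[ℝ] ℝ, HasFDerivWithinAt f L (univ ×ˢ S) (t, q) → 0 ≤ hjValue S H q L

/-- `u` is a locally Lipschitz viscosity solution on `I × S` of
`∂_t u + H (q, ∇_q u) = 0`, `u (0, ·) = u₀`. -/
structure IsLipViscositySolution {d : ℕ} (I : Set ℝ) (S : Set (Euc d)) (H : Euc d × Euc d → ℝ)
    (u₀ : Euc d → ℝ) (u : ℝ × Euc d → ℝ) : Prop where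
  locallyLipschitz : LocallyLipschitzOn (I ×ˢ S) u
  sub : IsViscositySubsolution I S H u
  super : IsViscositySupersolution I S H u
  initial : ∀ q ∈ S, u (0, q) = u₀ q

/-! ### The Hamiltonian flow -/

/-- The Hamiltonian vector field `X_H (q, p) = (∇_p H (q, p), -∇_q H (q, p))`. -/
def hamiltonianField {d : ℕ} (H : Euc d × Euc d → ℝ) (x : Euc d × Euc d) : Euc d × Euc d :=
  (gradient (fun p => H (x.1, p)) x.2, -gradient (fun q => H (q, x.2)) x.1)

/-- `A` is invariant under the (local) flow of `X_H`: an integral curve, defined on an open interval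
around time `0`, that starts in `A` stays in `A`. -/
def IsFlowInvariant {d : ℕ} (H : Euc d × Euc d → ℝ) (A : Set (Euc d × Euc d)) : Prop :=
  ∀ (J : Set ℝ) (γ : ℝ → Euc d × Euc d), IsOpen J → J.OrdConnected → (0 : ℝ) ∈ J →
    (∀ t ∈ J, HasDerivAt γ (hamiltonianField H (γ t)) t) → γ 0 ∈ A → ∀ t ∈ J, γ t ∈ A

/-! ### Tubular neighbourhoods -/

/-- `N_θ`, the pairs `(q, n)` in the normal bundle of `M` with `‖n‖ < θ q`. -/
def tubeDomain {d : ℕ} (M : Set (Euc d)) (θ : Euc d → ℝ) : Set (Euc d × Euc d) :=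
  {x | x.1 ∈ M ∧ x.2 ∈ (tangentAt M x.1)ᗮ ∧ ‖x.2‖ < θ x.1}

/-- The map `ψ (q, n) = q + n`. -/
def tubeMap {d : ℕ} (x : Euc d × Euc d) : Euc d := x.1 + x.2

/-- `U_θ = ψ (N_θ)`. -/
def tube {d : ℕ} (M : Set (Euc d)) (θ : Euc d → ℝ) : Set (Euc d) :=
  tubeMap '' tubeDomain M θ

/-- The inverse `ψ⁻¹ : U_θ → N_θ`. -/
def tubeInv {d : ℕ} (M : Set (Euc d)) (θ : Euc d → ℝ) : Euc d → Euc d × Euc d :=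
  Function.invFunOn tubeMap (tubeDomain M θ)

/-- `θ` is a positive continuous function on `M` for which `ψ` is a smooth diffeomorphism of `N_θ`
onto an open set `U_θ`. (Smoothness of `ψ` itself is automatic; a map into the submanifold `N_θ` is
smooth when it is smooth as a map into `ℝ^d × ℝ^d`.) -/
structure IsTubularRadius {d : ℕ} (M : Set (Euc d)) (θ : Euc d → ℝ) : Prop where
  continuousOn : ContinuousOn θ M
  pos : ∀ q ∈ M, 0 < θ q
  injOn : InjOn tubeMap (tubeDomain M θ)
  isOpen : IsOpen (tube M θ)
  smooth_inv : ContDiffOn ℝ ∞ (tubeInv M θ) (tube M θ)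

/-- The projection `q ↦ q̃` of `U_θ` onto `M`, the first component of `ψ⁻¹`. -/
def tubeProj {d : ℕ} (M : Set (Euc d)) (θ : Euc d → ℝ) (q : Euc d) : Euc d :=
  (tubeInv M θ q).1

/-- The endomorphism `v (q)` of `T_q̃ M`, the restriction to `T_q̃ M` of the differential at `q` of the
projection `q ↦ q̃`. This differential has values in `T_q̃ M`, so the final orthogonal projection onto
`T_q̃ M` only adjusts the codomain. -/
def tubeDiff {d : ℕ} (M : Set (Euc d)) (θ : Euc d → ℝ) (q : Euc d) :
    tangentAt M (tubeProj M θ q) →L[ℝ] tangentAt M (tubeProj M θ q) :=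
  (tangentProj M (tubeProj M θ q)).comp
    ((fderiv ℝ (tubeProj M θ) q).comp (tangentAt M (tubeProj M θ q)).subtypeL)

/-- The extended Hamiltonian `(q, p) ↦ H̄ (q̃, v (q)⁻¹ (Π_q̃ p))`. -/
def extendedHamiltonian {d : ℕ} (M : Set (Euc d)) (θ : Euc d → ℝ) (Hbar : Euc d × Euc d → ℝ) :
    Euc d × Euc d → ℝ := fun x =>
  Hbar (tubeProj M θ x.1,
    ((tubeDiff M θ x.1).inverse (tangentProj M (tubeProj M θ x.1) x.2) : Euc d))

/-- The extended initial datum `q ↦ ū₀ (q̃) + a ‖q - q̃‖²`. -/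
def extendedDatum {d : ℕ} (M : Set (Euc d)) (θ : Euc d → ℝ) (a : ℝ) (u₀bar : Euc d → ℝ) :
    Euc d → ℝ := fun q =>
  u₀bar (tubeProj M θ q) + a * ‖q - tubeProj M θ q‖ ^ 2

/-- The extended solution `(t, q) ↦ ū (t, q̃) + a ‖q - q̃‖²`. -/
def extendedSolution {d : ℕ} (M : Set (Euc d)) (θ : Euc d → ℝ) (a : ℝ) (ubar : ℝ × Euc d → ℝ) :
    ℝ × Euc d → ℝ := fun x =>
  ubar (x.1, tubeProj M θ x.2) + a * ‖x.2 - tubeProj M θ x.2‖ ^ 2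

end

/-! Restriction. Invariance keeps the base point of an integral curve in `M`, so `∇_p H` is tangent
to `M` and `H (q, ·)` ignores normal components of `p` (`eq_of_sub_mem_orthogonal`). Classical
solutions then restrict by restricting differentials. For a viscosity subsolution, extend a test
function from `M` by a local retraction `r`; by the Lipschitz bound it touches `u` up to `K ‖x - r
x‖`. Penalising by `n ‖x - r x‖²` gives true maxima converging to the base point with `n (x - r x)`
bounded (`exists_penalized_maxima`). In the limit the penalty only adds a covector vanishing on
tangent vectors, which `H` ignores.

Extension. The tubular projection `π` is half the gradient of `‖y‖² - ‖y - π y‖²`, so `Dπ` is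
symmetric (`inner_fderiv_tubeProj`). It kills normal vectors, and a local section (`exists_section`)
makes `v (q)` invertible. Hence the tangential part of `∇u` is `v (q) ∇ū`, and the extended
Hamiltonian undoes `v (q)` (`hjValue_tube`). Test functions on the tube are pulled back to `M` by
the section.

Supersolutions reduce to subsolutions by changing the signs of `u` and `p`. -/

open Set Filter Topology
open scoped ContDiff

/-! ### Tangent spaces and local retractions -/

section Tangent

variable {d : ℕ}

theorem mem_tangentAt_of_curve {S : Set (Euc d)} {q w : Euc d} {γ : ℝ → Euc d}
    (hγ : ContDiffAt ℝ ∞ γ 0) (h0 : γ 0 = q) (hS : ∀ᶠ t in 𝓝 (0 : ℝ), γ t ∈ S)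
    (hw : HasDerivAt γ w 0) : w ∈ tangentAt S q :=
  Submodule.subset_span ⟨γ, hγ, h0, hS, hw.deriv⟩

theorem contDiff_line (q w : Euc d) : ContDiff ℝ ∞ fun t : ℝ => q + t • w := by fun_prop

theorem hasDerivAt_line (q w : Euc d) (t : ℝ) : HasDerivAt (fun t : ℝ => q + t • w) w t := by
  simpa using ((hasDerivAt_id t).smul_const w).const_add q

theorem tendsto_line (q w : Euc d) : Tendsto (fun t : ℝ => q + t • w) (𝓝 0) (𝓝 q) := by
  have h := (contDiff_line q w).continuous.tendsto 0
  simpa using h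

/-- The tangent space of an open set is the whole space. -/
theorem tangentAt_eq_top {S : Set (Euc d)} {q : Euc d} (hS : S ∈ 𝓝 q) : tangentAt S q = ⊤ := by
  refine eq_top_iff.2 fun w _ => ?_
  exact mem_tangentAt_of_curve (contDiff_line q w).contDiffAt (by simp)
    ((tendsto_line q w).eventually hS) (hasDerivAt_line q w 0)

/-- The differential of a smooth map into `M` takes its values in the tangent spaces of `M`. -/
theorem map_mem_tangentAt {M : Set (Euc d)} {F : Euc d → Euc d} {F' : Euc d →L[ℝ] Euc d}
    {x : Euc d} (hF : ContDiffAt ℝ ∞ F x) (hF' : HasFDerivAt F F' x)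
    (hM : ∀ᶠ y in 𝓝 x, F y ∈ M) (h : Euc d) : F' h ∈ tangentAt M (F x) := by
  refine mem_tangentAt_of_curve (γ := fun t : ℝ => F (x + t • h)) ?_ (by simp)
    ((tendsto_line x h).eventually hM) ?_
  · exact ContDiffAt.comp (0 : ℝ) (by simpa using hF) (contDiff_line x h).contDiffAt
  · exact HasFDerivAt.comp_hasDerivAt (0 : ℝ) (by simpa using hF') (hasDerivAt_line x h 0)

/-- The differential of a map that fixes the points of `S` fixes the tangent vectors of `S`. -/
theorem map_tangentAt_eq_self {S : Set (Euc d)} {F : Euc d → Euc d} {F' : Euc d →L[ℝ] Euc d}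
    {q : Euc d} (hF' : HasFDerivAt F F' q) (hS : ∀ᶠ y in 𝓝[S] q, F y = y) {w : Euc d}
    (hw : w ∈ tangentAt S q) : F' w = w := by
  -- Vectors fixed by `F'` form a subspace, so the generating velocities suffice.
  suffices tangentAt S q ≤ LinearMap.eqLocus (F' : Euc d →ₗ[ℝ] Euc d) LinearMap.id from this hw
  refine Submodule.span_le.2 ?_
  rintro w ⟨γ, hγ, h0, hγS, rfl⟩
  have hd : HasDerivAt γ (deriv γ 0) 0 := (hγ.differentiableAt (by simp)).hasDerivAt
  have h1 : HasDerivAt (F ∘ γ) (F' (deriv γ 0)) 0 :=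
    HasFDerivAt.comp_hasDerivAt (0 : ℝ) (by rwa [h0]) hd
  have ht : Tendsto γ (𝓝 0) (𝓝[S] q) :=
    tendsto_nhdsWithin_iff.2 ⟨h0 ▸ hγ.continuousAt, hγS⟩
  have h2 : F ∘ γ =ᶠ[𝓝 0] γ := ht.eventually hS
  exact (h2.hasDerivAt_iff.1 h1).unique hd

/-- Near a point of a submanifold there is a smooth retraction onto the submanifold. -/
theorem IsSmoothSubmanifold.exists_retraction {m : ℕ} {M : Set (Euc d)}
    (hM : IsSmoothSubmanifold m M) {q : Euc d} (hq : q ∈ M) :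
    ∃ r : Euc d → Euc d, ContDiffAt ℝ ∞ r q ∧ (∀ᶠ x in 𝓝 q, r x ∈ M) ∧
      ∀ᶠ x in 𝓝 q, x ∈ M → r x = x := by
  obtain ⟨e, W, -, hqs, he, hes, heM⟩ := hM q hq
  set P : Euc d →L[ℝ] Euc d := W.starProjection with hP
  have hPW : ∀ y ∈ W, P y = y := fun y hy => Submodule.starProjection_eq_self_iff.2 hy
  have hPq : P (e q) = e q := hPW _ ((heM q hqs).1 hq)
  have heq : ContDiffAt ℝ ∞ e q := he.contDiffAt (e.open_source.mem_nhds hqs)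
  have hPe : ContDiffAt ℝ ∞ (fun x => P (e x)) q := P.contDiff.contDiffAt.comp q heq
  have htar : ∀ᶠ x in 𝓝 q, P (e x) ∈ e.target := by
    refine hPe.continuousAt.eventually (e.open_target.mem_nhds ?_)
    simpa only [hPq] using e.map_source hqs
  -- In the straightening chart `M` is `W`, and the orthogonal projection retracts onto it.
  refine ⟨fun x => e.symm (P (e x)), ?_, ?_, ?_⟩
  · refine ContDiffAt.comp q (g := e.symm) (hes.contDiffAt (e.open_target.mem_nhds ?_)) hPe
    simpa only [hPq] using e.map_source hqs
  · filter_upwards [htar] with x hx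
    rw [heM _ (e.map_target hx), e.right_inv hx]
    exact W.starProjection_apply_mem _
  · filter_upwards [e.open_source.mem_nhds hqs] with x hx hxM
    rw [hPW _ ((heM x hx).1 hxM), e.left_inv hx]

/-- The velocity of a differentiable curve in a submanifold is tangent to it. -/
theorem IsSmoothSubmanifold.deriv_mem_tangentAt {m : ℕ} {M : Set (Euc d)}
    (hM : IsSmoothSubmanifold m M) {γ : ℝ → Euc d} {w : Euc d} {t : ℝ}
    (hγM : ∀ᶠ s in 𝓝 t, γ s ∈ M) (hγ : HasDerivAt γ w t) : w ∈ tangentAt M (γ t) := by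
  have hq := hγM.self_of_nhds
  obtain ⟨r, hr, hrM, hrid⟩ := hM.exists_retraction hq
  have hr' := (hr.differentiableAt (by simp)).hasFDerivAt
  -- `γ` need not be smooth; but `Dr` fixes its velocity `w`, and the image of `Dr` is tangent
  -- because `r` is smooth.
  have h1 : r ∘ γ =ᶠ[𝓝 t] γ := by
    filter_upwards [hγM, hγ.continuousAt.eventually hrid] with s hs h using h hs
  have h2 : fderiv ℝ r (γ t) w = w :=
    (h1.hasDerivAt_iff.1 (hr'.comp_hasDerivAt t hγ)).unique hγ
  have h3 := map_mem_tangentAt hr hr' hrM w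
  rwa [h2, hrid.self_of_nhds hq] at h3

end Tangent

/-! ### Gradients along `S` and the sign change -/

section Gradient

variable {d : ℕ} {S : Set (Euc d)} {q : Euc d} {L : ℝ × Euc d →L[ℝ] ℝ}

theorem inner_spaceGrad {w : Euc d} (hw : w ∈ tangentAt S q) :
    inner ℝ (spaceGrad S q L : Euc d) w = L (0, w) := by
  have h : inner ℝ (spaceGrad S q L) (⟨w, hw⟩ : tangentAt S q) = L (0, w) := by
    rw [spaceGrad, InnerProductSpace.toDual_symm_apply]
    rfl
  simpa using h

theorem spaceGrad_eq_of_inner {g : Euc d} (hg : g ∈ tangentAt S q)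
    (h : ∀ w ∈ tangentAt S q, inner ℝ g w = L (0, w)) : (spaceGrad S q L : Euc d) = g := by
  have hmem : (spaceGrad S q L : Euc d) - g ∈ tangentAt S q := sub_mem (Subtype.coe_prop _) hg
  have := inner_sub_left (𝕜 := ℝ) (spaceGrad S q L : Euc d) g ((spaceGrad S q L : Euc d) - g)
  rw [inner_spaceGrad hmem, h _ hmem, sub_self, inner_self_eq_zero] at this
  exact sub_eq_zero.1 this

theorem hjValue_reflect (H : Euc d × Euc d → ℝ) :
    hjValue S (fun x => -H (x.1, -x.2)) q (-L) = -hjValue S H q L := by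
  have h : (spaceGrad S q (-L) : Euc d) = -(spaceGrad S q L : Euc d) :=
    spaceGrad_eq_of_inner (neg_mem (Subtype.coe_prop _)) fun w hw => by
      rw [inner_neg_left, inner_spaceGrad hw]; rfl
  simp only [hjValue, timePart, h, neg_neg, neg_add, neg_apply]

/-- Changing the signs of `u` and of the momentum exchanges super- and subsolutions. -/
theorem isViscositySupersolution_iff_neg {I : Set ℝ} {H : Euc d × Euc d → ℝ}
    {u : ℝ × Euc d → ℝ} : IsViscositySupersolution I S H u ↔
      IsViscositySubsolution I S (fun x => -H (x.1, -x.2)) (-u) := by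
  constructor
  · intro h t ht q hq f hf hmax L hL
    have hmin : IsLocalMinOn (fun x => u x - (-f) x) (I ×ˢ S) (t, q) := by
      have hfun : (fun x => u x - (-f) x) = fun x => -((-u) x - f x) := by
        funext x; simp only [Pi.neg_apply]; ring
      rw [hfun]
      exact hmax.neg
    have := h t ht q hq (-f) hf.neg hmin (-L) hL.neg
    rw [← neg_neg L, hjValue_reflect]
    linarith
  · intro h t ht q hq f hf hmin L hL
    have hmax : IsLocalMaxOn (fun x => (-u) x - (-f) x) (I ×ˢ S) (t, q) := by
      have hfun : (fun x => (-u) x - (-f) x) = fun x => -(u x - f x) := by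
        funext x; simp only [Pi.neg_apply]; ring
      rw [hfun]
      exact hmin.neg
    have := h t ht q hq (-f) hf.neg hmax (-L) hL.neg
    rw [hjValue_reflect] at this
    linarith

end Gradient

/-! ### Independence of `H` from normal momenta -/

section Restriction

variable {d m : ℕ} {M : Set (Euc d)} {H : Euc d × Euc d → ℝ}

/-- `C¹` regularity of the field gives an integral curve through every point. -/
theorem contDiff_hamiltonianField (hH : ContDiff ℝ 2 H) : ContDiff ℝ 1 (hamiltonianField H) := by
  have hD : ContDiff ℝ 1 (fderiv ℝ H) := hH.fderiv_right (by norm_num)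
  have hd : Differentiable ℝ H := hH.differentiable (by norm_num)
  have h1 : ∀ x : Euc d × Euc d, fderiv ℝ (fun p => H (x.1, p)) x.2 =
      (fderiv ℝ H x).comp (ContinuousLinearMap.inr ℝ _ _) := fun x =>
    ((hd x).hasFDerivAt.comp x.2 (hasFDerivAt_prodMk_right x.1 x.2)).fderiv
  have h2 : ∀ x : Euc d × Euc d, fderiv ℝ (fun q => H (q, x.2)) x.1 =
      (fderiv ℝ H x).comp (ContinuousLinearMap.inl ℝ _ _) := fun x =>
    ((hd x).hasFDerivAt.comp x.1 (hasFDerivAt_prodMk_left x.1 x.2)).fderiv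
  have h3 : ContDiff ℝ 1 (InnerProductSpace.toDual ℝ (Euc d)).symm :=
    (InnerProductSpace.toDual ℝ (Euc d)).symm.contDiff
  unfold hamiltonianField gradient
  simp only [h1, h2]
  exact (h3.comp (hD.clm_comp contDiff_const)).prodMk (h3.comp (hD.clm_comp contDiff_const)).neg

/-- If the flow leaves `M × ℝ^d` invariant, then `∇_p H` is tangent to `M`. -/
theorem gradient_mem_tangentAt (hM : IsSmoothSubmanifold m M) (hH : ContDiff ℝ 2 H)
    (hinv : IsFlowInvariant H (M ×ˢ (univ : Set (Euc d)))) {q : Euc d} (hq : q ∈ M) (p : Euc d) :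
    gradient (fun p => H (q, p)) p ∈ tangentAt M q := by
  obtain ⟨γ, h0, ε, hε, hγ⟩ := (contDiff_hamiltonianField hH).contDiffAt (x := (q, p))
    |>.exists_forall_mem_closedBall_exists_eq_forall_mem_Ioo_hasDerivAt₀ 0
  rw [zero_sub, zero_add] at hγ
  have h0mem : (0 : ℝ) ∈ Ioo (-ε) ε := ⟨neg_lt_zero.2 hε, hε⟩
  have hM' : ∀ t ∈ Ioo (-ε) ε, γ t ∈ M ×ˢ (univ : Set (Euc d)) :=
    hinv _ γ isOpen_Ioo ordConnected_Ioo h0mem hγ (by rw [h0]; exact ⟨hq, trivial⟩)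
  have hder : HasDerivAt (fun t => (γ t).1) (hamiltonianField H (q, p)).1 0 := by
    have := hγ 0 h0mem
    rw [h0] at this
    exact hasFDerivAt_fst.comp_hasDerivAt (0 : ℝ) this
  have h := hM.deriv_mem_tangentAt (γ := fun t => (γ t).1)
    (by filter_upwards [Ioo_mem_nhds h0mem.1 h0mem.2] with t ht using (hM' t ht).1) hder
  simp only [h0] at h
  exact h

/-- `∇_p H (q, ·)` is tangent at every momentum, so `H` has zero derivative along the normal segment
from `p'` to `p`. -/
theorem eq_of_sub_mem_orthogonal (hM : IsSmoothSubmanifold m M) (hH : ContDiff ℝ 2 H)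
    (hinv : IsFlowInvariant H (M ×ˢ (univ : Set (Euc d)))) {q : Euc d} (hq : q ∈ M)
    {p p' : Euc d} (h : p - p' ∈ (tangentAt M q)ᗮ) : H (q, p) = H (q, p') := by
  have hd : Differentiable ℝ fun p => H (q, p) :=
    (hH.differentiable (by norm_num)).comp (by fun_prop)
  have hder : ∀ s : ℝ, HasDerivAt (fun s : ℝ => H (q, p' + s • (p - p'))) 0 s := fun s => by
    have h1 := (hd (p' + s • (p - p'))).hasGradientAt.hasFDerivAt.comp_hasDerivAt s
      (hasDerivAt_line p' (p - p') s)
    rw [InnerProductSpace.toDual_apply_apply,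
      (Submodule.mem_orthogonal _ _).1 h _ (gradient_mem_tangentAt hM hH hinv hq _)] at h1
    exact h1
  have := is_const_of_deriv_eq_zero (fun s => (hder s).differentiableAt)
    (fun s => (hder s).deriv) 1 0
  simpa using this

end Restriction

/-! ### Restriction of solutions to `M` by penalisation -/

section RestrictionOfSolutions

variable {d m : ℕ} {M : Set (Euc d)} {H : Euc d × Euc d → ℝ} {I : Set ℝ}
  {u₀ : Euc d → ℝ} {u : ℝ × Euc d → ℝ}

/-- If `H` does not see the normal component of the momentum at `q`, the value of the
Hamilton-Jacobi operator along `M` can be computed from any differential on the ambient space that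
agrees along `M`. -/
theorem hjValue_univ_eq {q : Euc d}
    (hH : ∀ p p' : Euc d, p - p' ∈ (tangentAt M q)ᗮ → H (q, p) = H (q, p'))
    {L L' : ℝ × Euc d →L[ℝ] ℝ} (ht : L' (1, 0) = L (1, 0))
    (hx : ∀ w ∈ tangentAt M q, L' (0, w) = L (0, w)) :
    hjValue univ H q L' = hjValue M H q L := by
  unfold hjValue timePart
  rw [ht, hH _ (spaceGrad M q L) ?_]
  -- Both gradients pair equally with tangent vectors, so they differ by a normal vector.
  refine (Submodule.mem_orthogonal' _ _).2 fun w hw => ?_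
  have hw' : w ∈ tangentAt (univ : Set (Euc d)) q := by
    rw [tangentAt_eq_top univ_mem]; trivial
  rw [inner_sub_left, inner_spaceGrad hw, inner_spaceGrad hw', hx w hw, sub_self]

theorem IsClassicalSolution.restrict
    (hH : ∀ q ∈ M, ∀ p p' : Euc d, p - p' ∈ (tangentAt M q)ᗮ → H (q, p) = H (q, p'))
    (hu : IsClassicalSolution I univ H u₀ u) : IsClassicalSolution I M H u₀ u := by
  refine ⟨fun t ht q hq => ?_, fun q _ => hu.2 q trivial⟩
  obtain ⟨L, hL, h0⟩ := hu.1 t ht q trivial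
  exact ⟨L, hL.mono (prod_mono_right (subset_univ M)),
    by rw [← hjValue_univ_eq (hH q hq) rfl fun _ _ => rfl, h0]⟩

/-- Lets viscosity inequalities pass to the limit: on the whole space the gradient depends on the
covector alone. -/
theorem tendsto_hjValue_univ (hH : Continuous H) {ι : Type*} {l : Filter ι} {x : ι → Euc d}
    {q : Euc d} {L : ι → ℝ × Euc d →L[ℝ] ℝ} {L₀ : ℝ × Euc d →L[ℝ] ℝ}
    (hx : Tendsto x l (𝓝 q)) (hL : Tendsto L l (𝓝 L₀)) :
    Tendsto (fun i => hjValue univ H (x i) (L i)) l (𝓝 (hjValue univ H q L₀)) := by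
  have hgrad : ∀ (y : Euc d) (Λ : ℝ × Euc d →L[ℝ] ℝ), (spaceGrad univ y Λ : Euc d) =
      (InnerProductSpace.toDual ℝ (Euc d)).symm
        (Λ.comp (ContinuousLinearMap.inr ℝ ℝ (Euc d))) := fun y Λ => by
    refine spaceGrad_eq_of_inner (by rw [tangentAt_eq_top univ_mem]; trivial) fun w _ => ?_
    rw [InnerProductSpace.toDual_symm_apply]
    rfl
  unfold hjValue timePart
  simp only [hgrad]
  have hcont : Continuous fun y : Euc d × (ℝ × Euc d →L[ℝ] ℝ) =>
      y.2 (1, 0) + H (y.1, (InnerProductSpace.toDual ℝ (Euc d)).symm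
        (y.2.comp (ContinuousLinearMap.inr ℝ ℝ (Euc d)))) := by
    have h1 : Continuous fun y : Euc d × (ℝ × Euc d →L[ℝ] ℝ) =>
        (InnerProductSpace.toDual ℝ (Euc d)).symm
          (y.2.comp (ContinuousLinearMap.inr ℝ ℝ (Euc d))) :=
      (InnerProductSpace.toDual ℝ (Euc d)).symm.continuous.comp
        (continuous_snd.clm_comp continuous_const)
    exact (continuous_snd.clm_apply continuous_const).add
      (hH.comp (continuous_fst.prodMk h1))
  exact (hcont.tendsto (q, L₀)).comp (hx.prodMk_nhds hL)

/-- The penalised test function used to pass from `M` to the ambient space. -/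
noncomputable def penalized (F : ℝ × Euc d → ℝ) (r : Euc d → Euc d) (z₀ : ℝ × Euc d) (c : ℝ)
    (z : ℝ × Euc d) : ℝ :=
  F z + c * ‖z.2 - r z.2‖ ^ 2 + (‖z.2 - z₀.2‖ ^ 2 + ‖z.1 - z₀.1‖ ^ 2)

/-- The differential of `penalized F r z₀ c` at `z`, where `ξ = c • (z.2 - r z.2)`. -/
noncomputable def penalizedFDeriv (F : ℝ × Euc d → ℝ) (r : Euc d → Euc d) (z₀ z : ℝ × Euc d)
    (ξ : Euc d) : ℝ × Euc d →L[ℝ] ℝ :=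
  fderiv ℝ F z
    + (2 : ℝ) • (innerSL ℝ ξ).comp
      ((ContinuousLinearMap.id ℝ (Euc d) - fderiv ℝ r z.2).comp
        (ContinuousLinearMap.snd ℝ ℝ (Euc d)))
    + ((2 : ℝ) • (innerSL ℝ (z.2 - z₀.2)).comp (ContinuousLinearMap.snd ℝ ℝ (Euc d))
      + (2 : ℝ) • (innerSL ℝ (z.1 - z₀.1)).comp (ContinuousLinearMap.fst ℝ ℝ (Euc d)))

theorem Filter.Tendsto.clm_comp {E₁ E₂ E₃ : Type*} [NormedAddCommGroup E₁]
    [NormedSpace ℝ E₁] [NormedAddCommGroup E₂] [NormedSpace ℝ E₂] [NormedAddCommGroup E₃]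
    [NormedSpace ℝ E₃] {ι : Type*} {l : Filter ι} {A : ι → E₂ →L[ℝ] E₃} {B : ι → E₁ →L[ℝ] E₂}
    {a : E₂ →L[ℝ] E₃} {b : E₁ →L[ℝ] E₂} (hA : Tendsto A l (𝓝 a)) (hB : Tendsto B l (𝓝 b)) :
    Tendsto (fun i => (A i).comp (B i)) l (𝓝 (a.comp b)) :=
  ((continuous_fst.clm_comp continuous_snd).tendsto (a, b)).comp (hA.prodMk_nhds hB)

/-- The coefficient `c` will tend to infinity, but it enters only through `ξ`, which stays bounded;
hence `ξ` is an independent variable here. -/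
theorem tendsto_penalizedFDeriv {F : ℝ × Euc d → ℝ} {r : Euc d → Euc d} {z₀ : ℝ × Euc d}
    (hF : ContDiffAt ℝ 1 F z₀) (hr : ContDiffAt ℝ 1 r z₀.2) {ι : Type*} {l : Filter ι}
    {z : ι → ℝ × Euc d} {ξ : ι → Euc d} {η : Euc d} (hz : Tendsto z l (𝓝 z₀))
    (hξ : Tendsto ξ l (𝓝 η)) :
    Tendsto (fun i => penalizedFDeriv F r z₀ (z i) (ξ i)) l (𝓝 (penalizedFDeriv F r z₀ z₀ η)) := by
  have h1 : Tendsto (fun i => fderiv ℝ F (z i)) l (𝓝 (fderiv ℝ F z₀)) :=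
    (hF.continuousAt_fderiv (by simp)).tendsto.comp hz
  have hz1 : Tendsto (fun i => (z i).1) l (𝓝 z₀.1) := (continuous_fst.tendsto z₀).comp hz
  have hz2 : Tendsto (fun i => (z i).2) l (𝓝 z₀.2) := (continuous_snd.tendsto z₀).comp hz
  have h2 : Tendsto (fun i => fderiv ℝ r (z i).2) l (𝓝 (fderiv ℝ r z₀.2)) :=
    (hr.continuousAt_fderiv (by simp)).tendsto.comp hz2
  have h3 : Tendsto (fun i => innerSL ℝ (ξ i)) l (𝓝 (innerSL ℝ η)) :=
    ((innerSL ℝ).continuous.tendsto η).comp hξ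
  have h4 : Tendsto (fun i => innerSL ℝ ((z i).2 - z₀.2)) l (𝓝 (innerSL ℝ (z₀.2 - z₀.2))) :=
    ((innerSL ℝ).continuous.tendsto _).comp (hz2.sub_const _)
  have h5 : Tendsto (fun i => innerSL ℝ ((z i).1 - z₀.1)) l (𝓝 (innerSL ℝ (z₀.1 - z₀.1))) :=
    ((innerSL ℝ).continuous.tendsto _).comp (hz1.sub_const _)
  exact (h1.add ((h3.clm_comp ((h2.const_sub _).clm_comp tendsto_const_nhds)).const_smul _)).add
    (((h4.clm_comp tendsto_const_nhds).const_smul _).add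
      ((h5.clm_comp tendsto_const_nhds).const_smul _))

theorem hasFDerivAt_penalized {F : ℝ × Euc d → ℝ} {r : Euc d → Euc d} (z₀ : ℝ × Euc d) (c : ℝ)
    {z : ℝ × Euc d} (hF : DifferentiableAt ℝ F z) (hr : DifferentiableAt ℝ r z.2) :
    HasFDerivAt (penalized F r z₀ c)
      (penalizedFDeriv F r z₀ z (c • (z.2 - r z.2))) z := by
  have hs : HasFDerivAt (fun z : ℝ × Euc d => z.2) (ContinuousLinearMap.snd ℝ ℝ (Euc d)) z :=
    hasFDerivAt_snd
  have ht : HasFDerivAt (fun z : ℝ × Euc d => z.1) (ContinuousLinearMap.fst ℝ ℝ (Euc d)) z :=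
    hasFDerivAt_fst
  have h1 := ((hs.sub (hr.hasFDerivAt.comp z hs)).norm_sq).const_mul c
  have h2 := (hs.sub_const z₀.2).norm_sq
  have h3 := (ht.sub_const z₀.1).norm_sq
  refine ((hF.hasFDerivAt.add h1).add (h2.add h3)).congr_fderiv ?_
  refine ContinuousLinearMap.ext fun w => ?_
  simp only [penalizedFDeriv, add_apply, smul_apply, ContinuousLinearMap.comp_apply, sub_apply,
    Pi.sub_apply,
    Function.comp_apply, map_smul, innerSL_apply_apply, ContinuousLinearMap.coe_snd', nsmul_eq_mul,
    smul_eq_mul, ContinuousLinearMap.id_apply, ContinuousLinearMap.coe_fst',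
    Nat.cast_ofNat]
  ring

theorem ContDiffAt.penalized {F : ℝ × Euc d → ℝ} {r : Euc d → Euc d} {z : ℝ × Euc d}
    (hF : ContDiffAt ℝ 1 F z) (z₀ : ℝ × Euc d) (c : ℝ) (hr : ContDiffAt ℝ 1 r z.2) :
    ContDiffAt ℝ 1 (penalized F r z₀ c) z := by
  have h1 : ContDiffAt ℝ 1 (fun y : ℝ × Euc d => r y.2) z := hr.comp z contDiffAt_snd
  exact (hF.add (contDiffAt_const.mul ((contDiffAt_snd.sub h1).norm_sq ℝ))).add
    (((contDiffAt_snd.sub contDiffAt_const).norm_sq ℝ).add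
      ((contDiffAt_fst.sub contDiffAt_const).norm_sq ℝ))

/-- Maxima of `u - penalized F r z₀ n` near `z₀` converge to `z₀`, with a control on the distance to
the fixed points of `r`. -/
theorem exists_penalized_maxima {F u : ℝ × Euc d → ℝ} {r : Euc d → Euc d} {z₀ : ℝ × Euc d} {K : ℝ}
    (hK : 0 ≤ K) (hr₀ : r z₀.2 = z₀.2)
    (h : ∀ᶠ z in 𝓝 z₀, ContinuousAt u z ∧ ContinuousAt F z ∧ ContinuousAt r z.2 ∧
      u z - F z ≤ u z₀ - F z₀ + K * ‖z.2 - r z.2‖) :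
    ∃ z : ℕ → ℝ × Euc d, Tendsto z atTop (𝓝 z₀) ∧
      (∀ n : ℕ, ‖(n : ℝ) • ((z n).2 - r (z n).2)‖ ≤ K) ∧
      ∀ᶠ n in atTop, IsLocalMax (fun y => u y - penalized F r z₀ (n : ℕ) y) (z n) := by
  obtain ⟨δ, hδ, hball⟩ := Metric.nhds_basis_closedBall.eventually_iff.1 h
  have hmaxn : ∀ n : ℕ, ∃ z ∈ Metric.closedBall z₀ δ,
      IsMaxOn (fun z => u z - penalized F r z₀ n z) (Metric.closedBall z₀ δ) z := by
    intro n
    refine (isCompact_closedBall z₀ δ).exists_isMaxOn ⟨z₀, Metric.mem_closedBall_self hδ.le⟩ ?_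
    intro z hz
    obtain ⟨h1, h2, h3, -⟩ := hball hz
    have h4 : ContinuousAt (fun y : ℝ × Euc d => r y.2) z :=
      ContinuousAt.comp (f := Prod.snd) h3 continuousAt_snd
    refine ContinuousAt.continuousWithinAt ?_
    unfold penalized
    fun_prop
  choose z hzB hzmax using hmaxn
  -- Compare the maximum with the value at `z₀`, where all penalties vanish.
  have hest : ∀ n : ℕ, n * ‖(z n).2 - r (z n).2‖ ^ 2 +
      (‖(z n).2 - z₀.2‖ ^ 2 + ‖(z n).1 - z₀.1‖ ^ 2) ≤ K * ‖(z n).2 - r (z n).2‖ := by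
    intro n
    obtain ⟨-, -, -, h4⟩ := hball (hzB n)
    have h5 : u z₀ - penalized F r z₀ n z₀ ≤ u (z n) - penalized F r z₀ n (z n) :=
      hzmax n (Metric.mem_closedBall_self hδ.le)
    have h6 : penalized F r z₀ n z₀ = F z₀ := by simp [penalized, hr₀]
    rw [h6, penalized] at h5
    linarith
  -- Dividing `hest` by the distance bounds the multiplier uniformly in `n`.
  have hbd : ∀ n : ℕ, ‖(n : ℝ) • ((z n).2 - r (z n).2)‖ ≤ K := by
    intro n
    rw [norm_smul, Real.norm_natCast]
    have h1 := hest n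
    rcases (norm_nonneg ((z n).2 - r (z n).2)).eq_or_lt with h0 | h0
    · rwa [← h0, mul_zero]
    · refine le_of_mul_le_mul_right ?_ h0
      nlinarith [sq_nonneg ‖(z n).2 - z₀.2‖, sq_nonneg ‖(z n).1 - z₀.1‖]
  have hsq : ∀ n : ℕ, 0 < n → ‖(z n).2 - z₀.2‖ ^ 2 + ‖(z n).1 - z₀.1‖ ^ 2 ≤ K * (K / n) := by
    intro n hn
    have h1 := hest n
    have h2 := hbd n
    rw [norm_smul, Real.norm_natCast] at h2
    have hn' : (0 : ℝ) < n := by exact_mod_cast hn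
    have h3 : ‖(z n).2 - r (z n).2‖ ≤ K / n := by
      rw [le_div_iff₀ hn']; linarith
    have h4 := mul_le_mul_of_nonneg_left h3 hK
    have h5 : 0 ≤ (n : ℝ) * ‖(z n).2 - r (z n).2‖ ^ 2 := by positivity
    linarith
  have hlim0 : Tendsto (fun n : ℕ => K * (K / n)) atTop (𝓝 0) := by
    simpa using (tendsto_const_div_atTop_nhds_zero_nat K).const_mul K
  have hlimsq : Tendsto (fun n => √(‖(z n).2 - z₀.2‖ ^ 2 + ‖(z n).1 - z₀.1‖ ^ 2)) atTop (𝓝 0) := by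
    simpa using (squeeze_zero' (Eventually.of_forall fun n => by positivity)
      ((eventually_gt_atTop 0).mono hsq) hlim0).sqrt
  have hz2 : Tendsto (fun n => (z n).2) atTop (𝓝 z₀.2) :=
    tendsto_iff_norm_sub_tendsto_zero.2 (squeeze_zero (fun n => norm_nonneg _)
      (fun n => Real.le_sqrt_of_sq_le (le_add_of_nonneg_right (sq_nonneg _))) hlimsq)
  have hz1 : Tendsto (fun n => (z n).1) atTop (𝓝 z₀.1) :=
    tendsto_iff_norm_sub_tendsto_zero.2 (squeeze_zero (fun n => norm_nonneg _)
      (fun n => Real.le_sqrt_of_sq_le (le_add_of_nonneg_left (sq_nonneg _))) hlimsq)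
  have hz : Tendsto z atTop (𝓝 z₀) := hz1.prodMk_nhds hz2
  refine ⟨z, hz, hbd, ?_⟩
  filter_upwards [hz.eventually (Metric.ball_mem_nhds z₀ hδ)] with n hn
  exact (hzmax n).isLocalMax
    (mem_of_superset (Metric.isOpen_ball.mem_nhds hn) Metric.ball_subset_closedBall)

/-- A test function on `M` touching `u` from above extends to the ambient space, in such a way that
it touches up to a multiple of the distance to the fixed points of a retraction onto `M`. -/
theorem exists_test_extension (hM : IsSmoothSubmanifold m M)
    (hlip : LocallyLipschitzOn (I ×ˢ univ) u) {t : ℝ} (ht : t ∈ interior I) {q : Euc d}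
    (hq : q ∈ M) {f : ℝ × Euc d → ℝ} (hf : ContDiffWithinAt ℝ 1 f (univ ×ˢ M) (t, q))
    (hmax : IsLocalMaxOn (fun x => u x - f x) (I ×ˢ M) (t, q)) {L : ℝ × Euc d →L[ℝ] ℝ}
    (hL : HasFDerivWithinAt f L (univ ×ˢ M) (t, q)) :
    ∃ (r : Euc d → Euc d) (F : ℝ × Euc d → ℝ) (K : ℝ), 0 ≤ K ∧ ContDiffAt ℝ 1 r q ∧ r q = q ∧
      (∀ w ∈ tangentAt M q, fderiv ℝ r q w = w) ∧ ContDiffAt ℝ 1 F (t, q) ∧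
      (∀ s w, fderiv ℝ F (t, q) (s, w) = L (s, fderiv ℝ r q w)) ∧
      ∀ᶠ z in 𝓝 (t, q), ContinuousAt u z ∧
        u z - F z ≤ u (t, q) - F (t, q) + K * ‖z.2 - r z.2‖ := by
  obtain ⟨r, hr, hrM, hrid⟩ := hM.exists_retraction hq
  have hrq : r q = q := hrid.self_of_nhds hq
  have hr1 : ContDiffAt ℝ 1 r q := hr.of_le (by norm_cast)
  set z₀ : ℝ × Euc d := (t, q) with hz₀
  set R : ℝ × Euc d → ℝ × Euc d := fun z => (z.1, r z.2) with hR
  have hRz : R z₀ = z₀ := by simp [hR, hz₀, hrq]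
  have hRd : ContDiffAt ℝ 1 R z₀ := contDiffAt_fst.prodMk (hr1.comp z₀ contDiffAt_snd)
  have hRM : ∀ᶠ z in 𝓝 z₀, R z ∈ univ ×ˢ M := by
    filter_upwards [(continuous_snd.continuousAt (x := z₀)).eventually hrM] with z hz using ⟨trivial, hz⟩
  have hRin : Tendsto R (𝓝 z₀) (𝓝[univ ×ˢ M] z₀) :=
    tendsto_nhdsWithin_iff.2 ⟨by simpa only [hRz] using hRd.continuousAt.tendsto, hRM⟩
  have hI : ∀ᶠ z in 𝓝 z₀, z.1 ∈ I :=
    (continuous_fst.continuousAt (x := z₀)).eventually (mem_interior_iff_mem_nhds.1 ht)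
  -- `f` is controlled only along `M`, hence the composition with the retraction.
  set F : ℝ × Euc d → ℝ := f ∘ R with hF
  have hFd : ContDiffAt ℝ 1 F z₀ := by
    rw [← hRz] at hf
    rw [← contDiffWithinAt_univ] at hRd ⊢
    exact hf.comp_of_preimage_mem_nhdsWithin z₀ hRd (by rwa [nhdsWithin_univ])
  have hF' : HasFDerivAt F (L.comp ((ContinuousLinearMap.fst ℝ ℝ (Euc d)).prod
      ((fderiv ℝ r q).comp (ContinuousLinearMap.snd ℝ ℝ (Euc d))))) z₀ := by
    have h1 : HasFDerivAt R ((ContinuousLinearMap.fst ℝ ℝ (Euc d)).prod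
        ((fderiv ℝ r q).comp (ContinuousLinearMap.snd ℝ ℝ (Euc d)))) z₀ :=
      hasFDerivAt_fst.prodMk
        ((hr1.differentiableAt (by simp)).hasFDerivAt.comp z₀ hasFDerivAt_snd)
    rw [← hRz] at hL
    rw [← hasFDerivWithinAt_univ] at h1 ⊢
    exact hL.comp_of_tendsto z₀ h1 (by rwa [nhdsWithin_univ, hRz])
  have hmaxR : ∀ᶠ z in 𝓝 z₀, u (R z) - F z ≤ u z₀ - F z₀ := by
    have hRI : Tendsto R (𝓝 z₀) (𝓝[I ×ˢ M] z₀) := tendsto_nhdsWithin_iff.2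
      ⟨tendsto_nhds_of_tendsto_nhdsWithin hRin, (hI.and hRM).mono fun z hz => ⟨hz.1, hz.2.2⟩⟩
    filter_upwards [hRI.eventually hmax] with z hz
    simpa only [hF, Function.comp_apply, hRz] using hz
  obtain ⟨K, s, hs, hK⟩ := hlip (x := z₀) ⟨interior_subset ht, trivial⟩
  have hs' : s ∈ 𝓝 z₀ := by
    rwa [nhdsWithin_eq_nhds.2 (prod_mem_nhds (mem_interior_iff_mem_nhds.1 ht) univ_mem)] at hs
  -- Off `M` the touching fails by at most the Lipschitz constant times the distance from `z` to `R
  -- z`; `R` leaves time unchanged.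
  have hlipR : ∀ᶠ z in 𝓝 z₀, u z - u (R z) ≤ K * ‖z.2 - r z.2‖ := by
    filter_upwards [hs', (tendsto_nhds_of_tendsto_nhdsWithin hRin).eventually hs'] with z h1 h2
    have h3 := hK.dist_le_mul z h1 (R z) h2
    have h4 : dist z (R z) = ‖z.2 - r z.2‖ := by
      rw [Prod.dist_eq, dist_self, max_eq_right dist_nonneg, dist_eq_norm]
    rw [h4] at h3
    exact (le_abs_self _).trans h3
  have hucont : ∀ᶠ z in 𝓝 z₀, ContinuousAt u z :=
    (eventually_mem_nhds_iff.2 hs').mono fun z hz => hK.continuousOn.continuousAt hz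
  refine ⟨r, F, K, K.coe_nonneg, hr1, hrq, fun w hw => ?_, hFd, fun σ w => ?_, ?_⟩
  · exact map_tangentAt_eq_self (hr1.differentiableAt (by simp)).hasFDerivAt
      (eventually_nhdsWithin_iff.2 hrid) hw
  · rw [hF'.fderiv]; rfl
  · filter_upwards [hucont, hmaxR, hlipR] with z h1 h4 h5
    exact ⟨h1, by linarith⟩

/-- A viscosity subsolution on the ambient space restricts to `M`, if the Hamiltonian does not see
normal momenta along `M`. -/
theorem IsViscositySubsolution.restrict (hM : IsSmoothSubmanifold m M) (hHc : Continuous H)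
    (hH : ∀ q ∈ M, ∀ p p' : Euc d, p - p' ∈ (tangentAt M q)ᗮ → H (q, p) = H (q, p'))
    (hlip : LocallyLipschitzOn (I ×ˢ univ) u) (hu : IsViscositySubsolution I univ H u) :
    IsViscositySubsolution I M H u := by
  intro t ht q hq f hf hmax L hL
  obtain ⟨r, F, K, hK, hr1, hrq, hrT, hFd, hF', hev⟩ :=
    exists_test_extension hM hlip ht hq hf hmax hL
  have hFe := hFd.eventually (by simp)
  have hre := (continuous_snd.continuousAt (x := (t, q))).eventually (hr1.eventually (by simp))
  obtain ⟨z, hz, hbd, hzmax⟩ := exists_penalized_maxima hK hrq (by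
    filter_upwards [hev, hFe, hre] with z h1 h2 h3
    exact ⟨h1.1, h2.continuousAt, h3.continuousAt, h1.2⟩)
  obtain ⟨η, -, φ, hφ, hη⟩ := tendsto_subseq_of_bounded
    (Metric.isBounded_closedBall (x := (0 : Euc d)) (r := K))
    (x := fun n : ℕ => (n : ℝ) • ((z n).2 - r (z n).2))
    fun n => mem_closedBall_zero_iff.2 (hbd n)
  have hsub : ∀ᶠ n : ℕ in atTop,
      hjValue univ H (z n).2
        (penalizedFDeriv F r (t, q) (z n) ((n : ℝ) • ((z n).2 - r (z n).2))) ≤ 0 := by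
    filter_upwards [hzmax, hz.eventually hFe, hz.eventually hre,
      (continuous_fst.tendsto (t, q)).comp hz |>.eventually (isOpen_interior.mem_nhds ht)]
      with n hn h1 h2 hnt
    exact hu _ hnt _ trivial (penalized F r (t, q) n) (h1.penalized (t, q) n h2).contDiffWithinAt
      (hn.on _) _ (hasFDerivAt_penalized (t, q) n (h1.differentiableAt (by simp))
        (h2.differentiableAt (by simp))).hasFDerivWithinAt
  have hlim := tendsto_penalizedFDeriv hFd hr1 (hz.comp hφ.tendsto_atTop) hη
  have hle : hjValue univ H q (penalizedFDeriv F r (t, q) (t, q) η) ≤ 0 :=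
    le_of_tendsto (tendsto_hjValue_univ hHc
      ((continuous_snd.tendsto (t, q)).comp (hz.comp hφ.tendsto_atTop)) hlim)
      (hφ.tendsto_atTop.eventually hsub)
  -- `η` enters as `⟪η, w - Dr w⟫`, zero for tangent `w`; the other penalty has zero differential at
  -- its centre.
  refine (hjValue_univ_eq (hH q hq) ?_ fun w hw => ?_).symm.trans_le hle
  · simp [penalizedFDeriv, hF']
  · simp [penalizedFDeriv, hF', hrT w hw]

end RestrictionOfSolutions

/-! ### Geometry of the tubular projection -/

namespace IsTubularRadius

variable {d : ℕ} {M : Set (Euc d)} {θ : Euc d → ℝ}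

theorem tubeInv_mem {x : Euc d} (hx : x ∈ tube M θ) : tubeInv M θ x ∈ tubeDomain M θ :=
  Function.invFunOn_mem hx

theorem tubeMap_tubeInv {x : Euc d} (hx : x ∈ tube M θ) : tubeMap (tubeInv M θ x) = x :=
  Function.invFunOn_eq hx

theorem tubeProj_mem {x : Euc d} (hx : x ∈ tube M θ) : tubeProj M θ x ∈ M :=
  (tubeInv_mem hx).1

theorem sub_tubeProj {x : Euc d} (hx : x ∈ tube M θ) :
    x - tubeProj M θ x = (tubeInv M θ x).2 :=
  sub_eq_of_eq_add' (tubeMap_tubeInv hx).symm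

theorem sub_tubeProj_mem {x : Euc d} (hx : x ∈ tube M θ) :
    x - tubeProj M θ x ∈ (tangentAt M (tubeProj M θ x))ᗮ := by
  rw [sub_tubeProj hx]
  exact (tubeInv_mem hx).2.1

theorem inner_sub_tubeProj {x w : Euc d} (hx : x ∈ tube M θ)
    (hw : w ∈ tangentAt M (tubeProj M θ x)) : inner ℝ (x - tubeProj M θ x) w = 0 :=
  (Submodule.mem_orthogonal' _ _).1 (sub_tubeProj_mem hx) w hw

theorem norm_sub_tubeProj_lt {x : Euc d} (hx : x ∈ tube M θ) :
    ‖x - tubeProj M θ x‖ < θ (tubeProj M θ x) := by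
  rw [sub_tubeProj hx]
  exact (tubeInv_mem hx).2.2

variable (hθ : IsTubularRadius M θ)
include hθ

theorem mem_nhds {x : Euc d} (hx : x ∈ tube M θ) : tube M θ ∈ 𝓝 x := hθ.isOpen.mem_nhds hx

theorem add_mem_tube {x n : Euc d} (hx : x ∈ M) (hn : n ∈ (tangentAt M x)ᗮ) (hlt : ‖n‖ < θ x) :
    x + n ∈ tube M θ ∧ tubeProj M θ (x + n) = x := by
  have hmem : (x, n) ∈ tubeDomain M θ := ⟨hx, hn, hlt⟩
  have htube : x + n ∈ tube M θ := ⟨(x, n), hmem, rfl⟩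
  refine ⟨htube, ?_⟩
  exact congrArg Prod.fst (hθ.injOn (tubeInv_mem htube) hmem (tubeMap_tubeInv htube))

theorem subset_tube {x : Euc d} (hx : x ∈ M) : x ∈ tube M θ ∧ tubeProj M θ x = x := by
  simpa using hθ.add_mem_tube hx (zero_mem _) (by simpa using hθ.pos x hx)

theorem contDiffAt_tubeProj {x : Euc d} (hx : x ∈ tube M θ) : ContDiffAt ℝ ∞ (tubeProj M θ) x :=
  (hθ.smooth_inv.contDiffAt (hθ.mem_nhds hx)).fst

theorem hasFDerivAt_tubeProj {x : Euc d} (hx : x ∈ tube M θ) :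
    HasFDerivAt (tubeProj M θ) (fderiv ℝ (tubeProj M θ) x) x :=
  ((hθ.contDiffAt_tubeProj hx).differentiableAt (by simp)).hasFDerivAt

theorem fderiv_tubeProj_mem {x : Euc d} (hx : x ∈ tube M θ) (h : Euc d) :
    fderiv ℝ (tubeProj M θ) x h ∈ tangentAt M (tubeProj M θ x) :=
  map_mem_tangentAt (hθ.contDiffAt_tubeProj hx) (hθ.hasFDerivAt_tubeProj hx)
    (mem_of_superset (hθ.mem_nhds hx) fun _ hy => tubeProj_mem hy) h

/-- The fibre through `x` is an open ball in an affine normal space, so short normal displacements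
stay in it. -/
theorem eventually_tubeProj_line {x n : Euc d} (hx : x ∈ tube M θ)
    (hn : n ∈ (tangentAt M (tubeProj M θ x))ᗮ) :
    ∀ᶠ s in 𝓝 (0 : ℝ), x + s • n ∈ tube M θ ∧ tubeProj M θ (x + s • n) = tubeProj M θ x := by
  have h3 : Tendsto (fun s : ℝ => ‖x + s • n - tubeProj M θ x‖) (𝓝 0)
      (𝓝 ‖x - tubeProj M θ x‖) := ((tendsto_line x n).sub_const _).norm
  filter_upwards [h3.eventually (gt_mem_nhds (norm_sub_tubeProj_lt hx))] with s hs
  have h4 := hθ.add_mem_tube (tubeProj_mem hx) (n := x + s • n - tubeProj M θ x) ?_ hs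
  · rwa [add_sub_cancel] at h4
  · rw [add_sub_right_comm]
    exact add_mem (sub_tubeProj_mem hx) (Submodule.smul_mem _ s hn)

/-- The differential of the projection vanishes on normal vectors. -/
theorem fderiv_tubeProj_normal {x n : Euc d} (hx : x ∈ tube M θ)
    (hn : n ∈ (tangentAt M (tubeProj M θ x))ᗮ) : fderiv ℝ (tubeProj M θ) x n = 0 := by
  have h1 : HasDerivAt (tubeProj M θ ∘ fun s : ℝ => x + s • n) (fderiv ℝ (tubeProj M θ) x n) 0 :=
    HasFDerivAt.comp_hasDerivAt (0 : ℝ) (by simpa using hθ.hasFDerivAt_tubeProj hx)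
      (hasDerivAt_line x n 0)
  have h2 : (tubeProj M θ ∘ fun s : ℝ => x + s • n) =ᶠ[𝓝 0] fun _ => tubeProj M θ x :=
    (hθ.eventually_tubeProj_line hx hn).mono fun s hs => hs.2
  exact (h2.hasDerivAt_iff.1 h1).unique (hasDerivAt_const _ _)

/-- The differential of the projection is a symmetric operator. -/
theorem inner_fderiv_tubeProj {x : Euc d} (hx : x ∈ tube M θ) (v w : Euc d) :
    inner ℝ (fderiv ℝ (tubeProj M θ) x v) w = inner ℝ v (fderiv ℝ (tubeProj M θ) x w) := by
  -- the projection is the gradient of `(‖y‖² - ‖y - tubeProj y‖²) / 2`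
  have hpot : ∀ᶠ y in 𝓝 x, HasFDerivAt
      (fun y => (1 / 2 : ℝ) * (‖y‖ ^ 2 - ‖y - tubeProj M θ y‖ ^ 2))
      (innerSL ℝ (tubeProj M θ y)) y := by
    filter_upwards [hθ.mem_nhds hx] with y hy
    refine ((((hasFDerivAt_id y).norm_sq).sub
      (((hasFDerivAt_id y).sub (hθ.hasFDerivAt_tubeProj hy)).norm_sq)).const_mul _).congr_fderiv ?_
    refine ContinuousLinearMap.ext fun w => ?_
    -- The leftover term `⟪y - π y, Dπ w⟫` vanishes, being normal against tangent.
    have h1 := inner_sub_tubeProj hy (hθ.fderiv_tubeProj_mem hy w)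
    simp [inner_sub_left] at h1 ⊢
    linarith
  have h2 : HasFDerivAt (fun y => innerSL ℝ (tubeProj M θ y))
      ((innerSL ℝ).comp (fderiv ℝ (tubeProj M θ) x)) x :=
    (innerSL ℝ).hasFDerivAt.comp x (hθ.hasFDerivAt_tubeProj hx)
  have h3 := second_derivative_symmetric_of_eventually hpot h2 v w
  simp only [ContinuousLinearMap.comp_apply, innerSL_apply_apply] at h3
  rw [h3, real_inner_comm]

/-- Through every point of the tube there is a smooth local section of the projection. -/
theorem exists_section {q : Euc d} (hq : q ∈ tube M θ) :
    ∃ σ : Euc d → Euc d, ContDiffAt ℝ ∞ σ (tubeProj M θ q) ∧ σ (tubeProj M θ q) = q ∧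
      ∀ᶠ x in 𝓝[M] tubeProj M θ q, σ x ∈ tube M θ ∧ tubeProj M θ (σ x) = x := by
  set q' := tubeProj M θ q with hq'
  have hqM : q' ∈ M := tubeProj_mem hq
  obtain ⟨hqt, hqq⟩ := hθ.subset_tube hqM
  set n := q - q' with hn
  have hD : ContDiffAt ℝ ∞ (fun x => n - fderiv ℝ (tubeProj M θ) x n) q' :=
    contDiffAt_const.sub
      (((hθ.contDiffAt_tubeProj hqt).fderiv_right (m := ∞) (by simp)).clm_apply contDiffAt_const)
  have h0 : fderiv ℝ (tubeProj M θ) q' n = 0 :=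
    hθ.fderiv_tubeProj_normal hqt (by rw [hqq]; exact sub_tubeProj_mem hq)
  -- On `M`, `Dπ` is the orthogonal projector onto the tangent space, so the section adds to `x` the
  -- normal part of `n` at `x`.
  refine ⟨fun x => x + (n - fderiv ℝ (tubeProj M θ) x n), contDiffAt_id.add hD, ?_, ?_⟩
  · simp only [h0, sub_zero]
    exact add_sub_cancel _ _
  have hlt : ∀ᶠ x in 𝓝[M] q', ‖n - fderiv ℝ (tubeProj M θ) x n‖ < θ x := by
    refine Tendsto.eventually_lt (hD.continuousAt.continuousWithinAt.norm) (hθ.continuousOn q' hqM) ?_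
    simpa [h0] using norm_sub_tubeProj_lt hq
  filter_upwards [hlt, self_mem_nhdsWithin] with x hx hxM
  obtain ⟨hxt, hxx⟩ := hθ.subset_tube hxM
  refine hθ.add_mem_tube hxM ((Submodule.mem_orthogonal' _ _).2 fun w hw => ?_) hx
  have h1 : fderiv ℝ (tubeProj M θ) x w = w := map_tangentAt_eq_self
    (hθ.hasFDerivAt_tubeProj hxt)
    (eventually_nhdsWithin_of_forall fun y hy => (hθ.subset_tube hy).2) hw
  rw [inner_sub_left, hθ.inner_fderiv_tubeProj hxt, h1, sub_self]

/-- The differential of a local section is a right inverse, on tangent vectors, of the differential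
of the projection. -/
theorem fderiv_tubeProj_section {q : Euc d} (hq : q ∈ tube M θ) {σ : Euc d → Euc d}
    {σ' : Euc d →L[ℝ] Euc d} (hσ : HasFDerivAt σ σ' (tubeProj M θ q)) (hσq : σ (tubeProj M θ q) = q)
    (hσM : ∀ᶠ x in 𝓝[M] tubeProj M θ q, σ x ∈ tube M θ ∧ tubeProj M θ (σ x) = x) {w : Euc d}
    (hw : w ∈ tangentAt M (tubeProj M θ q)) : fderiv ℝ (tubeProj M θ) q (σ' w) = w := by
  have h : HasFDerivAt (tubeProj M θ ∘ σ) ((fderiv ℝ (tubeProj M θ) q).comp σ') (tubeProj M θ q) :=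
    HasFDerivAt.comp _ (by rw [hσq]; exact hθ.hasFDerivAt_tubeProj hq) hσ
  exact map_tangentAt_eq_self h (hσM.mono fun x hx => hx.2) hw

theorem coe_tubeDiff {q : Euc d} (hq : q ∈ tube M θ) (w : tangentAt M (tubeProj M θ q)) :
    (tubeDiff M θ q w : Euc d) = fderiv ℝ (tubeProj M θ) q w :=
  congrArg Subtype.val (Submodule.orthogonalProjectionOnto_mem_subspace_eq_self
    (⟨_, hθ.fderiv_tubeProj_mem hq w⟩ : tangentAt M (tubeProj M θ q)))

/-- The differential of the projection does not see normal components. -/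
theorem fderiv_tubeProj_tangentProj {q : Euc d} (hq : q ∈ tube M θ) (h : Euc d) :
    fderiv ℝ (tubeProj M θ) q (tangentProj M (tubeProj M θ q) h) =
      fderiv ℝ (tubeProj M θ) q h := by
  have h1 : h - tangentProj M (tubeProj M θ q) h ∈ (tangentAt M (tubeProj M θ q))ᗮ :=
    Submodule.sub_starProjection_mem_orthogonal h
  have h2 := hθ.fderiv_tubeProj_normal hq h1
  rw [map_sub, sub_eq_zero] at h2
  exact h2.symm

/-- In finite dimension surjectivity suffices. A preimage of `w` is the tangential part of `Dσ w`,
since `Dπ` kills the normal part. -/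
theorem isInvertible_tubeDiff {q : Euc d} (hq : q ∈ tube M θ) : (tubeDiff M θ q).IsInvertible := by
  obtain ⟨σ, hσ, hσq, hσM⟩ := hθ.exists_section hq
  have hσ' := (hσ.differentiableAt (by simp)).hasFDerivAt
  have hsurj : Function.Surjective
      (tubeDiff M θ q : tangentAt M (tubeProj M θ q) →ₗ[ℝ] tangentAt M (tubeProj M θ q)) := by
    intro w
    refine ⟨tangentProj M (tubeProj M θ q) (fderiv ℝ σ (tubeProj M θ q) w), Subtype.ext ?_⟩
    rw [ContinuousLinearMap.coe_coe, hθ.coe_tubeDiff hq, hθ.fderiv_tubeProj_tangentProj hq]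
    exact hθ.fderiv_tubeProj_section hq hσ' hσq hσM w.2
  exact ⟨(LinearEquiv.ofBijective _ ⟨LinearMap.injective_iff_surjective.2 hsurj, hsurj⟩)
    |>.toContinuousLinearEquiv, rfl⟩

/-- The momentum seen by the extended Hamiltonian is characterised by its image under `v (q)`. -/
theorem extendedHamiltonian_eq {q : Euc d} (hq : q ∈ tube M θ) (Hbar : Euc d × Euc d → ℝ)
    {p g : Euc d} (hg : g ∈ tangentAt M (tubeProj M θ q))
    (h : ∀ w ∈ tangentAt M (tubeProj M θ q),
      inner ℝ p w = inner ℝ (fderiv ℝ (tubeProj M θ) q g) w) :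
    extendedHamiltonian M θ Hbar (q, p) = Hbar (tubeProj M θ q, g) := by
  have h1 : tangentProj M (tubeProj M θ q) p = tubeDiff M θ q ⟨g, hg⟩ := by
    refine ext_inner_right ℝ fun w => ?_
    rw [Submodule.coe_inner, Submodule.coe_inner, hθ.coe_tubeDiff hq, ← h w w.2]
    rw [real_inner_comm, real_inner_comm _ p]
    exact Submodule.inner_orthogonalProjectionOnto_eq_of_mem_left w p
  unfold extendedHamiltonian
  rw [((hθ.isInvertible_tubeDiff hq).inverse_apply_eq (x := ⟨g, hg⟩)).2 h1]

/-- By symmetry of `Dπ`, the tangential gradient of `L` is `v (q)` applied to that of `Lbar`, which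
the extended Hamiltonian inverts. The normal part of `L` is free. -/
theorem hjValue_tube {q : Euc d} (hq : q ∈ tube M θ) (Hbar : Euc d × Euc d → ℝ)
    {L Lbar : ℝ × Euc d →L[ℝ] ℝ} (ht : L (1, 0) = Lbar (1, 0))
    (hx : ∀ w ∈ tangentAt M (tubeProj M θ q),
      L (0, w) = Lbar (0, fderiv ℝ (tubeProj M θ) q w)) :
    hjValue (tube M θ) (extendedHamiltonian M θ Hbar) q L =
      hjValue M Hbar (tubeProj M θ q) Lbar := by
  unfold hjValue timePart
  rw [ht, hθ.extendedHamiltonian_eq hq Hbar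
    (Subtype.coe_prop (spaceGrad M (tubeProj M θ q) Lbar)) fun w hw => ?_]
  rw [inner_spaceGrad (by rw [tangentAt_eq_top (hθ.mem_nhds hq)]; trivial), hx w hw,
    hθ.inner_fderiv_tubeProj hq, inner_spaceGrad (hθ.fderiv_tubeProj_mem hq w)]

/-- The kernel of a symmetric operator is orthogonal to its range, and the section shows that the
range contains the tangent space. -/
theorem mem_orthogonal_of_fderiv_tubeProj_eq_zero {q h : Euc d} (hq : q ∈ tube M θ)
    (h0 : fderiv ℝ (tubeProj M θ) q h = 0) : h ∈ (tangentAt M (tubeProj M θ q))ᗮ := by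
  refine (Submodule.mem_orthogonal' _ _).2 fun w hw => ?_
  obtain ⟨σ, hσ, hσq, hσM⟩ := hθ.exists_section hq
  obtain ⟨k, hk⟩ : ∃ k, fderiv ℝ (tubeProj M θ) q k = w :=
    ⟨_, hθ.fderiv_tubeProj_section hq (hσ.differentiableAt (by simp)).hasFDerivAt hσq hσM hw⟩
  rw [← hk, ← hθ.inner_fderiv_tubeProj hq, h0, inner_zero_left]

/-! ### Extension of solutions to the tube -/

theorem isClassicalSolution_extended {I : Set ℝ} {Hbar : Euc d × Euc d → ℝ} {u₀bar : Euc d → ℝ}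
    {ubar : ℝ × Euc d → ℝ} (a : ℝ) (hu : IsClassicalSolution I M Hbar u₀bar ubar) :
    IsClassicalSolution I (tube M θ) (extendedHamiltonian M θ Hbar)
      (extendedDatum M θ a u₀bar) (extendedSolution M θ a ubar) := by
  refine ⟨fun t ht q hq => ?_, fun q hq => ?_⟩
  · obtain ⟨Lbar, hL, h0⟩ := hu.1 t ht _ (tubeProj_mem hq)
    have hs : HasFDerivAt (fun z : ℝ × Euc d => z.2) (ContinuousLinearMap.snd ℝ ℝ (Euc d)) (t, q) :=
      hasFDerivAt_snd
    have hπ : HasFDerivAt (fun z : ℝ × Euc d => tubeProj M θ z.2)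
        ((fderiv ℝ (tubeProj M θ) q).comp (ContinuousLinearMap.snd ℝ ℝ (Euc d))) (t, q) :=
      HasFDerivAt.comp (g := tubeProj M θ) (t, q) (hθ.hasFDerivAt_tubeProj hq) hs
    have h1 := HasFDerivWithinAt.comp (t, q) (t := I ×ˢ M) (s := I ×ˢ tube M θ) hL
      (hasFDerivAt_fst.prodMk hπ).hasFDerivWithinAt
      (fun z hz => ⟨hz.1, tubeProj_mem hz.2⟩)
    have h2 := ((hs.sub hπ).norm_sq.const_mul a).hasFDerivWithinAt (s := I ×ˢ tube M θ)
    refine ⟨_, h1.add h2, ?_⟩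
    rw [hθ.hjValue_tube hq Hbar (Lbar := Lbar) ?_ ?_, h0]
    · simp
    -- The quadratic term contributes `2a ⟪q - π q, w - Dπ w⟫`, which is zero for tangent `w`.
    · intro w hw
      have h3 := inner_sub_tubeProj hq hw
      have h4 := inner_sub_tubeProj hq (hθ.fderiv_tubeProj_mem hq w)
      simp only [inner_sub_left] at h3 h4
      simp
      exact Or.inr (by linarith)
  · simp only [extendedSolution, extendedDatum, hu.2 _ (tubeProj_mem hq)]

theorem locallyLipschitzOn_extended {I : Set ℝ} {ubar : ℝ × Euc d → ℝ} (a : ℝ)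
    (hu : LocallyLipschitzOn (I ×ˢ M) ubar) :
    LocallyLipschitzOn (I ×ˢ tube M θ) (extendedSolution M θ a ubar) := by
  rintro ⟨t, q⟩ ⟨ht, hq⟩
  have hπ : ContDiffAt ℝ 1 (fun z : ℝ × Euc d => tubeProj M θ z.2) (t, q) :=
    ((hθ.contDiffAt_tubeProj hq).of_le (by norm_cast)).comp (t, q) contDiffAt_snd
  obtain ⟨K₁, s₁, hs₁, hK₁⟩ := hu (x := (t, tubeProj M θ q)) ⟨ht, tubeProj_mem hq⟩
  obtain ⟨K₂, s₂, hs₂, hK₂⟩ := (contDiffAt_fst.prodMk hπ).exists_lipschitzOnWith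
  obtain ⟨K₃, s₃, hs₃, hK₃⟩ := (contDiffAt_const (c := a)).mul
    ((contDiffAt_snd.sub hπ).norm_sq ℝ) |>.exists_lipschitzOnWith
  have hR : Tendsto (fun z : ℝ × Euc d => (z.1, tubeProj M θ z.2)) (𝓝[I ×ˢ tube M θ] (t, q))
      (𝓝[I ×ˢ M] (t, tubeProj M θ q)) :=
    ((contDiffAt_fst.prodMk hπ).continuousAt.continuousWithinAt.tendsto_nhdsWithin
      fun z hz => ⟨hz.1, tubeProj_mem hz.2⟩)
  refine ⟨K₁ * K₂ + K₃, (s₂ ∩ s₃) ∩ (fun z : ℝ × Euc d => (z.1, tubeProj M θ z.2)) ⁻¹' s₁,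
    inter_mem (mem_nhdsWithin_of_mem_nhds (inter_mem hs₂ hs₃)) (hR hs₁), ?_⟩
  exact (hK₁.comp (hK₂.mono fun z hz => hz.1.1) fun z hz => hz.2).add
    (hK₃.mono fun z hz => hz.1.2)

/-- A section `σ` pulls `f` back to a test function for `ubar`, after removing the quadratic term.
As `Dσ` inverts `Dπ` only modulo normal vectors, the normal derivative of `f` is also needed; it
comes from moving along the fibre. -/
theorem isViscositySubsolution_extended {I : Set ℝ} {Hbar : Euc d × Euc d → ℝ}
    {ubar : ℝ × Euc d → ℝ} (a : ℝ) (hu : IsViscositySubsolution I M Hbar ubar) :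
    IsViscositySubsolution I (tube M θ) (extendedHamiltonian M θ Hbar)
      (extendedSolution M θ a ubar) := by
  intro t ht q hq f hf hmax L hL
  have hnhds : univ ×ˢ tube M θ ∈ 𝓝 (t, q) := prod_mem_nhds univ_mem (hθ.mem_nhds hq)
  replace hf := hf.contDiffAt hnhds
  replace hL := hL.hasFDerivAt hnhds
  set q' := tubeProj M θ q with hq'
  obtain ⟨σ, hσ, hσq, hσM⟩ := hθ.exists_section hq
  rw [← hq'] at hσ hσq hσM
  have hσ' := (hσ.differentiableAt (by simp)).hasFDerivAt
  -- the normal component of the differential of `f`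
  have hnormal : ∀ n ∈ (tangentAt M q')ᗮ, L (0, n) = 2 * a * inner ℝ (q - q') n := by
    intro n hn
    have hline := hθ.eventually_tubeProj_line hq hn
    have ht1 : Tendsto (fun s : ℝ => (t, q + s • n)) (𝓝 0) (𝓝[I ×ˢ tube M θ] (t, q)) :=
      tendsto_nhdsWithin_iff.2 ⟨tendsto_const_nhds.prodMk_nhds (tendsto_line q n),
        hline.mono fun s hs => ⟨interior_subset ht, hs.1⟩⟩
    -- The `ubar` term is constant along the fibre and drops out.
    have hloc : IsLocalMax (fun s : ℝ => a * ‖q + s • n - q'‖ ^ 2 - f (t, q + s • n)) 0 := by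
      filter_upwards [ht1.eventually hmax, hline] with s hs h2
      simp only [extendedSolution, h2.2, ← hq'] at hs
      simp only [zero_smul, add_zero]
      linarith
    have hd1 : HasDerivAt (fun s : ℝ => f (t, q + s • n)) (L (0, n)) 0 :=
      HasFDerivAt.comp_hasDerivAt (0 : ℝ) (f := fun s : ℝ => (t, q + s • n)) (by simpa using hL)
        ((hasDerivAt_const _ _).prodMk (hasDerivAt_line q n 0))
    have hd2 := (((hasDerivAt_line q n 0).sub_const q').norm_sq.const_mul a).sub hd1
    have h0 := hloc.hasDerivAt_eq_zero hd2
    simp only [zero_smul, add_zero] at h0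
    linarith
  set R : ℝ × Euc d → ℝ × Euc d := fun z => (z.1, σ z.2) with hR
  have hs : HasFDerivAt (fun z : ℝ × Euc d => z.2) (ContinuousLinearMap.snd ℝ ℝ (Euc d)) (t, q') :=
    hasFDerivAt_snd
  have hσs : HasFDerivAt (fun z : ℝ × Euc d => σ z.2)
      ((fderiv ℝ σ q').comp (ContinuousLinearMap.snd ℝ ℝ (Euc d))) (t, q') :=
    hσ'.comp (t, q') hs
  have hσ1 : ContDiffAt ℝ 1 (fun z : ℝ × Euc d => σ z.2) (t, q') :=
    (hσ.of_le (by norm_cast)).comp (t, q') contDiffAt_snd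
  have hRq : R (t, q') = (t, q) := by simp only [hR, hσq]
  have hfR : ContDiffAt ℝ 1 (fun z => f (R z) - a * ‖σ z.2 - z.2‖ ^ 2) (t, q') :=
    (ContDiffAt.comp (t, q') (f := R) (by rwa [hRq]) (contDiffAt_fst.prodMk hσ1)).sub
      (contDiffAt_const.mul ((hσ1.sub contDiffAt_snd).norm_sq ℝ))
  have hfR' := (HasFDerivAt.comp (t, q') (f := R) (by rwa [hRq]) (hasFDerivAt_fst.prodMk hσs)).sub
    ((hσs.sub hs).norm_sq.const_mul a)
  have hσM' : ∀ᶠ z in 𝓝[I ×ˢ M] (t, q'), σ z.2 ∈ tube M θ ∧ tubeProj M θ (σ z.2) = z.2 := by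
    have h : Tendsto (fun z : ℝ × Euc d => z.2) (𝓝[I ×ˢ M] (t, q')) (𝓝[M] q') :=
      continuous_snd.continuousWithinAt.tendsto_nhdsWithin fun z hz => hz.2
    exact h.eventually hσM
  have hRin : Tendsto R (𝓝[I ×ˢ M] (t, q')) (𝓝[I ×ˢ tube M θ] (t, q)) := by
    refine tendsto_nhdsWithin_iff.2 ⟨?_, ?_⟩
    · rw [← hRq]
      exact (contDiffAt_fst.prodMk hσ1).continuousAt.continuousWithinAt
    · filter_upwards [hσM', self_mem_nhdsWithin] with z hz hzI using ⟨hzI.1, hz.1⟩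
  have hmax' : IsLocalMaxOn (fun z => ubar z - (f (R z) - a * ‖σ z.2 - z.2‖ ^ 2)) (I ×ˢ M)
      (t, q') := by
    filter_upwards [hRin.eventually hmax, hσM'] with z hz h2
    simp only [extendedSolution, hR, h2.2, ← hq'] at hz
    simp only [hR, hσq]
    linarith
  have hle := hu t ht q' (tubeProj_mem hq) _ hfR.contDiffWithinAt hmax' _ hfR'.hasFDerivWithinAt
  refine (hθ.hjValue_tube hq Hbar ?_ ?_).trans_le hle
  · simp
  · intro w hw
    set k := fderiv ℝ (tubeProj M θ) q w with hk
    have hkT : k ∈ tangentAt M q' := hθ.fderiv_tubeProj_mem hq w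
    -- `Dσ (Dπ w)` and `w` have the same image under `Dπ`.
    have he : fderiv ℝ σ q' k - w ∈ (tangentAt M q')ᗮ := by
      refine hθ.mem_orthogonal_of_fderiv_tubeProj_eq_zero hq ?_
      rw [map_sub, hθ.fderiv_tubeProj_section hq hσ' hσq hσM hkT, sub_self]
    have h1 := hnormal _ he
    have h2 : L (0, fderiv ℝ σ q' k) = L (0, w) + L (0, fderiv ℝ σ q' k - w) := by
      rw [← map_add]; simp
    have h3 : inner ℝ (q - q') w = 0 := inner_sub_tubeProj hq hw
    have h4 : inner ℝ (q - q') k = 0 := inner_sub_tubeProj hq hkT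
    simp only [inner_sub_right, inner_sub_left] at h1 h3 h4
    simp [hσq]
    linear_combination -h2 - h1 + 2 * a * h3 - 2 * a * h4

theorem isLipViscositySolution_extended {I : Set ℝ} {Hbar : Euc d × Euc d → ℝ}
    {u₀bar : Euc d → ℝ} {ubar : ℝ × Euc d → ℝ} (a : ℝ)
    (hu : IsLipViscositySolution I M Hbar u₀bar ubar) :
    IsLipViscositySolution I (tube M θ) (extendedHamiltonian M θ Hbar)
      (extendedDatum M θ a u₀bar) (extendedSolution M θ a ubar) where
  locallyLipschitz := hθ.locallyLipschitzOn_extended a hu.locallyLipschitz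
  sub := hθ.isViscositySubsolution_extended a hu.sub
  super := by
    -- Negation turns `a` into `-a`; reflecting the momentum commutes with extending the Hamiltonian
    -- because `v (q)⁻¹ Π` is linear.
    have h := hθ.isViscositySubsolution_extended (-a) (isViscositySupersolution_iff_neg.1 hu.super)
    rw [isViscositySupersolution_iff_neg]
    convert h using 1
    · funext x
      simp [extendedHamiltonian]
    · funext x
      simp [extendedSolution, add_comm]
  initial q hq := by
    simp only [extendedSolution, extendedDatum, hu.initial _ (tubeProj_mem hq)]

end IsTubularRadius

/-! ### Restriction of viscosity solutions and the main theorem -/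

theorem IsLipViscositySolution.restrict {d m : ℕ} {M : Set (Euc d)} (hM : IsSmoothSubmanifold m M)
    {I : Set ℝ} {H : Euc d × Euc d → ℝ} {u₀ : Euc d → ℝ} {u : ℝ × Euc d → ℝ} (hHc : Continuous H)
    (hH : ∀ q ∈ M, ∀ p p' : Euc d, p - p' ∈ (tangentAt M q)ᗮ → H (q, p) = H (q, p'))
    (hu : IsLipViscositySolution I univ H u₀ u) : IsLipViscositySolution I M H u₀ u where
  locallyLipschitz := hu.locallyLipschitz.mono (prod_mono_right (subset_univ M))
  sub := hu.sub.restrict hM hHc hH hu.locallyLipschitz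
  super := by
    refine isViscositySupersolution_iff_neg.2 (IsViscositySubsolution.restrict hM (by fun_prop)
      (fun q hq p p' h => ?_) ?_ (isViscositySupersolution_iff_neg.1 hu.super))
    · refine congrArg Neg.neg (hH q hq _ _ ?_)
      rw [neg_sub_neg, ← neg_sub]
      exact neg_mem h
    · intro x hx
      obtain ⟨K, s, hs, hK⟩ := hu.locallyLipschitz hx
      exact ⟨K, s, hs, hK.neg⟩
  initial q _ := hu.initial q trivial

theorem theorem1 (d m : ℕ) (M : Set (Euc d)) (hMclosed : IsClosed M)
    (hM : IsSmoothSubmanifold m M) (I : Set ℝ) (hI : IsTimeInterval I) :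
    -- (a) restriction
    (∀ (H : Euc d × Euc d → ℝ) (u₀ : Euc d → ℝ) (u : ℝ × Euc d → ℝ),
      ContDiff ℝ 2 H → (∃ K, LipschitzWith K u₀) →
      IsFlowInvariant H (M ×ˢ (univ : Set (Euc d))) →
        (IsClassicalSolution I univ H u₀ u → IsClassicalSolution I M H u₀ u) ∧
        (IsLipViscositySolution I univ H u₀ u → IsLipViscositySolution I M H u₀ u)) ∧
    -- (b) extension; first, `v (q)` is well defined and an automorphism of the tangent space
    (∀ θ : Euc d → ℝ, IsTubularRadius M θ →
      (∀ q ∈ tube M θ,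
        (∀ w : tangentAt M (tubeProj M θ q),
          (tubeDiff M θ q w : Euc d) = fderiv ℝ (tubeProj M θ) q (w : Euc d)) ∧
        (tubeDiff M θ q).IsInvertible) ∧
      ∀ (Hbar : Euc d × Euc d → ℝ) (u₀bar : Euc d → ℝ) (ubar : ℝ × Euc d → ℝ) (a : ℝ),
        ContDiffOn ℝ 1 Hbar (tangentBundleSet M) → ContDiffOn ℝ 1 u₀bar M →
          (IsClassicalSolution I M Hbar u₀bar ubar →
            IsClassicalSolution I (tube M θ) (extendedHamiltonian M θ Hbar)
              (extendedDatum M θ a u₀bar) (extendedSolution M θ a ubar)) ∧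
          (IsLipViscositySolution I M Hbar u₀bar ubar →
            IsLipViscositySolution I (tube M θ) (extendedHamiltonian M θ Hbar)
              (extendedDatum M θ a u₀bar) (extendedSolution M θ a ubar))) := by
  refine ⟨fun H u₀ u hH _ hinv => ?_, fun θ hθ => ⟨fun q hq => ⟨hθ.coe_tubeDiff hq,
    hθ.isInvertible_tubeDiff hq⟩, fun Hbar u₀bar ubar a _ _ =>
    ⟨hθ.isClassicalSolution_extended a, hθ.isLipViscositySolution_extended a⟩⟩⟩
  have hnormal : ∀ q ∈ M, ∀ p p' : Euc d, p - p' ∈ (tangentAt M q)ᗮ → H (q, p) = H (q, p') :=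
    fun q hq p p' h => eq_of_sub_mem_orthogonal hM hH hinv hq h
  exact ⟨fun hu => hu.restrict hnormal, fun hu => hu.restrict hM hH.continuous hnormal⟩
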